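/- Let $\mathbb K$ be $\mathbb R$ or $\mathbb C$. Let $\Lambda$ be the Banach algebra of supernumbers over $\mathbb K$ with countably many anticommuting generators $\zeta^1,\zeta^2,\dots$: its elements are the formal series $z=\sum_I z_I\zeta^I$, over finite sets $I$ of indices, with $\|z\|=\sum_I|z_I|<\infty$; ${}^0\Lambda$ and ${}^1\Lambda$ denote its even and odd parts. Let $\mathbb K^{p|q}=({}^0\Lambda)^p\times({}^1\Lambda)^q$ with norm $\|z\|=\sum_A\|z^A\|$. A Banach super vector space $V=V^0\oplus V^1$ is a $\mathbb Z_2$-graded left $\Lambda$-module that is a Banach space over $\mathbb K$ with continuous $\Lambda$-action and closed parts $V^0,V^1$, and that admits a pure basis $\{e_A\}_{1\le A\le p+q}$ for some finite $p,q$, i.e. a $\Lambda$-basis with $e_1,\dots,e_p$ even and $e_{p+1},\dots,e_{p+q}$ odd. We write $v=\sum_A v^Ae_A$ with $v^A\in\Lambda$; a pure basis gives a global chart $V^0\to\mathbb K^{p|q}$, $x\mapsto(x^A)_A$. A function $\varphi:\mathbb K^{p|q}\to\Lambda$ is $G^1$ if there are functions $G_A\varphi:\mathbb K^{p|q}\to\Lambda$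 with $\varphi(a+h)=\varphi(a)+\sum_A h^A\,G_A\varphi(a)+o(\|h\|)$ as $h\to0$, for every $a$. It is $G^{s}$, $s\ge2$, if it is $G^1$ and the $G_A\varphi$ can be chosen $G^{s-1}$; it is $G^\infty$ if it is $G^s$ for all $s\ge1$. A map $f:\mathfrak g^0\to\mathfrak v^0$ between even parts of Banach super vector spaces is $G^\infty$ if, in the charts given by pure bases of $\mathfrak g$ and $\mathfrak v$, all its components $f^B$ are $G^\infty$. For $\varphi:\mathfrak g^0\to\Lambda$, a pure basis $\{e_A\}$ of $\mathfrak g$ with coordinates $u^A$ on $\mathfrak g^0$, and $x\in\mathfrak g^0$, the map $d_x\varphi:\mathfrak g\to\Lambda$ is the Fréchet derivative on $\mathfrak g^0$ ($0$, by convention, if it does not exist), and $d_x\varphi(X)=\sum_A X^A\frac{\partial\varphi}{\partial u^A}(x)$ for the other $X\in\mathfrak g$, where $\frac{\partial\varphi}{\partial u^A}(x)$ is the coefficient $G_A$ of the expansion above, in the chart at $x$ (and $0$, by convention, if $\varphi$ has no such expansion at $x$; when it has one, both formulas agree on $\mathfrak g^0$). The higher derivatives are defined by $d^1_x\varphi=d_x\varphi$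 and $$d^{k+1}_x\varphi(X_1,\dots,X_{k+1})=d_x\bigl[y\mapsto d^k_y\varphi(X_2,\dots,X_{k+1})\bigr](X_1).$$ A map $\beta:\mathfrak g^k\to\Lambda$ is multilinear over $\mathfrak g^0$ if for some pure basis $\{e_A\}$ of $\mathfrak g$ $$\beta(v_1,\dots,v_k)=\sum_{A_1,\dots,A_k}v_1^{A_1}v_2^{A_2}\cdots v_k^{A_k}\,\beta(e_{A_k},\dots,e_{A_2},e_{A_1})\qquad\text{for all }v_1,\dots,v_k\in\mathfrak g^0 .$$ **Proposition.** Let $\mathfrak g$ and $\mathfrak v$ be Banach super vector spaces with fixed pure bases, and let $f:\mathfrak g^0\to\mathfrak v^0$ be a $C^\infty$ map of Banach spaces. Then $f$ is of class $G^\infty$ if and only if for every $x\in\mathfrak g^0$, every positive integer $k$ and every component $f^B$ of $f$, the derivative $d^k_xf^B:\mathfrak g^k\to\Lambda$ is multilinear over $\mathfrak g^0$. (If $\mathbb K=\mathbb C$, the statement holds both with $C^\infty$ and Fréchet derivatives taken over $\mathbb C$ and with both taken over $\mathbb R$.) -/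

import Mathlib

open scoped Topology ContDiff

/-! ### Supernumbers -/

/-- The supernumbers over `𝕜`: families of coefficients `z I`, indexed by the finite sets `I` of
generators (so `z` stands for the formal series `∑ I, z I ζ^I`), with `‖z‖ = ∑ I, |z I|` finite. -/
def Supernumber (𝕜 : Type*) [RCLike 𝕜] : Type _ := lp (fun _ : Finset ℕ => 𝕜) 1

namespace Supernumber

noncomputable section

variable {𝕜 : Type*} [RCLike 𝕜]

instance : NormedAddCommGroup (Supernumber 𝕜) :=
  inferInstanceAs (NormedAddCommGroup (lp (fun _ : Finset ℕ => 𝕜) 1))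

instance {𝔽 : Type*} [NormedField 𝔽] [NormedSpace 𝔽 𝕜] : NormedSpace 𝔽 (Supernumber 𝕜) :=
  inferInstanceAs (NormedSpace 𝔽 (lp (fun _ : Finset ℕ => 𝕜) 1))

instance : CompleteSpace (Supernumber 𝕜) :=
  inferInstanceAs (CompleteSpace (lp (fun _ : Finset ℕ => 𝕜) 1))

/-- The coefficient of `ζ^I`. -/
def coeff (z : Supernumber 𝕜) (I : Finset ℕ) : 𝕜 :=
  (show lp (fun _ : Finset ℕ => 𝕜) 1 from z) I

@[ext] theorem ext {z w : Supernumber 𝕜} (h : ∀ I, z.coeff I = w.coeff I) : z = w :=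
  lp.ext (funext h)

@[simp] theorem coeff_add (z w : Supernumber 𝕜) (I : Finset ℕ) :
    (z + w).coeff I = z.coeff I + w.coeff I := rfl

@[simp] theorem coeff_zero (I : Finset ℕ) : (0 : Supernumber 𝕜).coeff I = 0 := rfl

@[simp] theorem coeff_smul {𝔽 : Type*} [NormedField 𝔽] [NormedSpace 𝔽 𝕜] (c : 𝔽)
    (z : Supernumber 𝕜) (I : Finset ℕ) : (c • z).coeff I = c • z.coeff I := rfl

theorem summable_norm_coeff (z : Supernumber 𝕜) : Summable fun I => ‖z.coeff I‖ := by
  have h := lp.memℓp (show lp (fun _ : Finset ℕ => 𝕜) 1 from z)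
  have h' := (memℓp_gen_iff (p := 1) (by norm_num)).1 h
  simp only [ENNReal.toReal_one, Real.rpow_one] at h'
  exact h'

theorem norm_eq_tsum (z : Supernumber 𝕜) : ‖z‖ = ∑' I, ‖z.coeff I‖ := by
  have h := lp.norm_eq_tsum_rpow (p := 1) (by norm_num)
    (show lp (fun _ : Finset ℕ => 𝕜) 1 from z)
  simp only [ENNReal.toReal_one, Real.rpow_one, div_one] at h
  exact h

/-- The supernumber with a given absolutely summable family of coefficients. -/
def ofCoeff (a : Finset ℕ → 𝕜) (ha : Summable fun I => ‖a I‖) : Supernumber 𝕜 :=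
  show lp (fun _ : Finset ℕ => 𝕜) 1 from
    ⟨a, (memℓp_gen_iff (p := 1) (by norm_num)).2 (by simpa using ha)⟩

@[simp] theorem coeff_ofCoeff (a : Finset ℕ → 𝕜) (ha : Summable fun I => ‖a I‖) (I : Finset ℕ) :
    (ofCoeff a ha).coeff I = a I := rfl

/-- The number of pairs that have to be interchanged to sort the word `ζ^J ζ^K`. -/
def inversions (J K : Finset ℕ) : ℕ := ((J ×ˢ K).filter fun x => x.2 < x.1).card

theorem inversions_union_left {J K L : Finset ℕ} (h : Disjoint J K) :
    inversions (J ∪ K) L = inversions J L + inversions K L := by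
  unfold inversions
  rw [Finset.union_product, Finset.filter_union, Finset.card_union_of_disjoint]
  exact Finset.disjoint_filter_filter (Finset.disjoint_product.2 (Or.inl h))

theorem inversions_union_right {J K L : Finset ℕ} (h : Disjoint K L) :
    inversions J (K ∪ L) = inversions J K + inversions J L := by
  unfold inversions
  rw [Finset.product_union, Finset.filter_union, Finset.card_union_of_disjoint]
  exact Finset.disjoint_filter_filter (Finset.disjoint_product.2 (Or.inr h))

/-- Coefficients of the product, from `ζ^J ζ^K = (-1)^(inversions J K) ζ^(J ∪ K)` for disjoint
`J`, `K`, and `ζ^J ζ^K = 0` otherwise. -/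
def mulCoeff (z w : Finset ℕ → 𝕜) (I : Finset ℕ) : 𝕜 :=
  ∑ J ∈ I.powerset, (-1) ^ inversions J (I \ J) * (z J * w (I \ J))

theorem mulCoeff_bound (z w : Supernumber 𝕜) :
    (Summable fun I => ‖mulCoeff z.coeff w.coeff I‖) ∧
      ∑' I, ‖mulCoeff z.coeff w.coeff I‖ ≤ ‖z‖ * ‖w‖ := by
  have hz := z.summable_norm_coeff
  have hw := w.summable_norm_coeff
  have hprod : Summable fun x : Finset ℕ × Finset ℕ => ‖z.coeff x.1‖ * ‖w.coeff x.2‖ :=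
    hz.mul_of_nonneg hw (fun _ => norm_nonneg _) (fun _ => norm_nonneg _)
  let i : (Σ I : Finset ℕ, {J // J ∈ I.powerset}) → Finset ℕ × Finset ℕ :=
    fun x => (x.2.1, x.1 \ x.2.1)
  have hi : Function.Injective i := by
    rintro ⟨I, J, hJ⟩ ⟨I', J', hJ'⟩ h
    simp only [i, Prod.mk.injEq] at h
    obtain ⟨rfl, h⟩ := h
    have : I = I' := by
      rw [← Finset.union_sdiff_of_subset (Finset.mem_powerset.1 hJ), h,
        Finset.union_sdiff_of_subset (Finset.mem_powerset.1 hJ')]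
    subst this
    rfl
  have hs := hprod.comp_injective hi
  have hb : ∀ I, ‖mulCoeff z.coeff w.coeff I‖ ≤
      ∑' J : {J // J ∈ I.powerset}, ‖z.coeff J.1‖ * ‖w.coeff (I \ J.1)‖ := by
    intro I
    rw [Finset.tsum_subtype I.powerset fun J => ‖z.coeff J‖ * ‖w.coeff (I \ J)‖]
    refine (norm_sum_le _ _).trans (le_of_eq (Finset.sum_congr rfl fun J _ => ?_))
    simp
  have hsum := Summable.of_nonneg_of_le (fun I => norm_nonneg _) hb hs.sigma
  refine ⟨hsum, ?_⟩
  calc ∑' I, ‖mulCoeff z.coeff w.coeff I‖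
      ≤ ∑' I : Finset ℕ, ∑' J : {J // J ∈ I.powerset}, ‖z.coeff J.1‖ * ‖w.coeff (I \ J.1)‖ :=
        hsum.tsum_le_tsum hb hs.sigma
    _ = ∑' x, ((fun x : Finset ℕ × Finset ℕ => ‖z.coeff x.1‖ * ‖w.coeff x.2‖) ∘ i) x :=
        hs.tsum_sigma.symm
    _ ≤ ∑' x : Finset ℕ × Finset ℕ, ‖z.coeff x.1‖ * ‖w.coeff x.2‖ :=
        tsum_comp_le_tsum_of_inj hprod (fun x => by positivity) hi
    _ = ‖z‖ * ‖w‖ := by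
        rw [norm_eq_tsum, norm_eq_tsum, hz.tsum_mul_tsum hw hprod]

instance : Mul (Supernumber 𝕜) :=
  ⟨fun z w => ofCoeff (mulCoeff z.coeff w.coeff) (mulCoeff_bound z w).1⟩

theorem coeff_mul (z w : Supernumber 𝕜) (I : Finset ℕ) :
    (z * w).coeff I = ∑ J ∈ I.powerset, (-1) ^ inversions J (I \ J) *
      (z.coeff J * w.coeff (I \ J)) := rfl

theorem summable_one : Summable fun I : Finset ℕ => ‖(if I = ∅ then 1 else 0 : 𝕜)‖ :=
  summable_of_ne_finset_zero (s := {∅}) fun I hI => by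
    simp only [Finset.mem_singleton] at hI
    simp [hI]

instance : One (Supernumber 𝕜) := ⟨ofCoeff (fun I => if I = ∅ then 1 else 0) summable_one⟩

theorem coeff_one (I : Finset ℕ) : (1 : Supernumber 𝕜).coeff I = if I = ∅ then 1 else 0 := rfl

theorem one_mul' (z : Supernumber 𝕜) : 1 * z = z := by
  ext I
  rw [coeff_mul, Finset.sum_eq_single ∅]
  · simp [coeff_one, inversions]
  · intro J _ hJ
    simp [coeff_one, hJ]
  · simp

theorem mul_one' (z : Supernumber 𝕜) : z * 1 = z := by
  ext I
  rw [coeff_mul, Finset.sum_eq_single I]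
  · simp [coeff_one, inversions]
  · intro J hJ hne
    have : I \ J ≠ ∅ := by
      intro h
      exact hne (Finset.Subset.antisymm (Finset.mem_powerset.1 hJ) (Finset.sdiff_eq_empty_iff_subset.1 h))
    simp [coeff_one, this]
  · simp

theorem mul_assoc' (z w u : Supernumber 𝕜) : z * w * u = z * (w * u) := by
  ext I
  simp only [coeff_mul, Finset.sum_mul, Finset.mul_sum]
  rw [Finset.sum_sigma', Finset.sum_sigma']
  refine Finset.sum_bij' (fun x _ => ⟨x.2, x.1 \ x.2⟩) (fun y _ => ⟨y.1 ∪ y.2, y.1⟩) ?_ ?_ ?_ ?_ ?_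
  · rintro ⟨J, K⟩ h
    simp only [Finset.mem_sigma, Finset.mem_powerset] at h ⊢
    exact ⟨h.2.trans h.1, Finset.sdiff_subset_sdiff h.1 le_rfl⟩
  · rintro ⟨K, L⟩ h
    simp only [Finset.mem_sigma, Finset.mem_powerset] at h ⊢
    exact ⟨Finset.union_subset h.1 (h.2.trans Finset.sdiff_subset), Finset.subset_union_left⟩
  · rintro ⟨J, K⟩ h
    simp only [Finset.mem_sigma, Finset.mem_powerset] at h
    simp [Finset.union_sdiff_of_subset h.2]
  · rintro ⟨K, L⟩ h
    simp only [Finset.mem_sigma, Finset.mem_powerset] at h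
    have hd : Disjoint L K := Finset.disjoint_of_subset_left h.2 Finset.sdiff_disjoint
    simp only [Finset.union_sdiff_left, Finset.sdiff_eq_self_of_disjoint hd]
  · rintro ⟨J, K⟩ h
    simp only [Finset.mem_sigma, Finset.mem_powerset] at h
    obtain ⟨hJ, hK⟩ := h
    have h1 : (I \ K) \ (J \ K) = I \ J := by
      ext x
      simp only [Finset.mem_sdiff]
      constructor
      · rintro ⟨⟨a, b⟩, c⟩
        exact ⟨a, fun d => c ⟨d, b⟩⟩
      · rintro ⟨a, b⟩
        exact ⟨⟨a, fun d => b (hK d)⟩, fun d => b d.1⟩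
    have h2 : I \ K = (J \ K) ∪ (I \ J) := by
      rw [← h1, Finset.union_sdiff_of_subset (Finset.sdiff_subset_sdiff hJ le_rfl)]
    have h3 : inversions J (I \ J) = inversions K (I \ J) + inversions (J \ K) (I \ J) := by
      conv_lhs => rw [← Finset.union_sdiff_of_subset hK]
      rw [Finset.union_sdiff_of_subset hK]
      rw [← inversions_union_left Finset.disjoint_sdiff, Finset.union_sdiff_of_subset hK]
    have h4 : inversions K (I \ K) = inversions K (J \ K) + inversions K (I \ J) := by
      rw [h2, inversions_union_right]
      exact Finset.disjoint_of_subset_left Finset.sdiff_subset Finset.disjoint_sdiff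
    simp only [h1]
    rw [h3, h4, pow_add, pow_add]
    ring

instance : NormedRing (Supernumber 𝕜) :=
  { (inferInstance : NormedAddCommGroup (Supernumber 𝕜)) with
    mul := (· * ·)
    one := 1
    mul_assoc := mul_assoc'
    one_mul := one_mul'
    mul_one := mul_one'
    left_distrib := fun z w u => by
      ext I
      simp only [coeff_mul, coeff_add, ← Finset.sum_add_distrib]
      exact Finset.sum_congr rfl fun J _ => by ring
    right_distrib := fun z w u => by
      ext I
      simp only [coeff_mul, coeff_add, ← Finset.sum_add_distrib]
      exact Finset.sum_congr rfl fun J _ => by ring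
    zero_mul := fun z => by ext I; simp [coeff_mul]
    mul_zero := fun z => by ext I; simp [coeff_mul]
    norm_mul_le := fun z w => by
      rw [norm_eq_tsum (z * w)]
      exact (mulCoeff_bound z w).2 }

/-- The supernumbers of parity `ε`: even ones for `ε = 0`, odd ones for `ε = 1`. -/
def ofParity (𝕜 : Type*) [RCLike 𝕜] (ε : ZMod 2) : Submodule 𝕜 (Supernumber 𝕜) where
  carrier := {z | ∀ I : Finset ℕ, (I.card : ZMod 2) ≠ ε → z.coeff I = 0}
  add_mem' := fun hz hw I hI => by simp [hz I hI, hw I hI]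
  zero_mem' := fun _ _ => rfl
  smul_mem' := fun c z hz I hI => by simp [hz I hI]

/-- Every supernumber is the sum of one of parity `ε` and one of parity `1 + ε`. -/
theorem exists_parity_add (ε : ZMod 2) (z : Supernumber 𝕜) :
    ∃ a ∈ ofParity 𝕜 ε, ∃ b ∈ ofParity 𝕜 (1 + ε), a + b = z := by
  have ha : Summable fun I : Finset ℕ => ‖(if (I.card : ZMod 2) = ε then z.coeff I else 0 : 𝕜)‖ :=
    Summable.of_nonneg_of_le (fun _ => norm_nonneg _)
      (fun I => by split_ifs <;> simp) z.summable_norm_coeff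
  have hb : Summable fun I : Finset ℕ => ‖(if (I.card : ZMod 2) = ε then 0 else z.coeff I : 𝕜)‖ :=
    Summable.of_nonneg_of_le (fun _ => norm_nonneg _)
      (fun I => by split_ifs <;> simp) z.summable_norm_coeff
  refine ⟨ofCoeff _ ha, fun I hI => by simp [hI], ofCoeff _ hb, fun I hI => ?_, ?_⟩
  · have : ∀ x y : ZMod 2, x ≠ 1 + y → x = y := by decide
    simp [this _ _ hI]
  · ext I
    by_cases h : (I.card : ZMod 2) = ε <;> simp [h]

end

end Supernumber

/-! ### Banach super vector spaces and pure bases -/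

/-- A Banach super vector space: a Banach space over `𝕜` that is a graded left module over the
supernumbers, the module action being continuous and the homogeneous parts being closed. -/
class BanachSuperSpace (𝕜 V : Type*) [RCLike 𝕜] [NormedAddCommGroup V] [NormedSpace 𝕜 V]
    [Module (Supernumber 𝕜) V] extends CompleteSpace V, IsScalarTower 𝕜 (Supernumber 𝕜) V,
    ContinuousSMul (Supernumber 𝕜) V where
  /-- The vectors of a given parity. -/
  grade : ZMod 2 → Submodule 𝕜 V
  isCompl_grade : IsCompl (grade 0) (grade 1)
  isClosed_grade : ∀ i, IsClosed (grade i : Set V)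
  smul_mem_grade : ∀ {i j : ZMod 2} {a : Supernumber 𝕜} {v : V},
    a ∈ Supernumber.ofParity 𝕜 i → v ∈ grade j → a • v ∈ grade (i + j)

/-- The even part of a Banach super vector space. -/
abbrev evenPart (𝕜 V : Type*) [RCLike 𝕜] [NormedAddCommGroup V] [NormedSpace 𝕜 V]
    [Module (Supernumber 𝕜) V] [BanachSuperSpace 𝕜 V] : Submodule 𝕜 V :=
  BanachSuperSpace.grade 0

/-- The parity of an index: the first `p` indices are even, the last `q` are odd. -/
def indexParity {p q : ℕ} : Fin p ⊕ Fin q → ZMod 2 :=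
  Sum.elim (fun _ => 0) (fun _ => 1)

/-- A pure basis of graded dimension `(p, q)`: every vector is `∑ A, v^A e_A` with unique
supernumbers `v^A`; the first `p` basis vectors are even and the last `q` are odd. -/
structure PureBasis (𝕜 : Type*) [RCLike 𝕜] (p q : ℕ) (V : Type*) [NormedAddCommGroup V]
    [NormedSpace 𝕜 V] [Module (Supernumber 𝕜) V] [BanachSuperSpace 𝕜 V] where
  toBasis : Module.Basis (Fin p ⊕ Fin q) (Supernumber 𝕜) V
  pure : ∀ A, toBasis A ∈ BanachSuperSpace.grade (𝕜 := 𝕜) (V := V) (indexParity A)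

/-! ### The model space and `G^∞` functions -/

noncomputable section

/-- The model space `𝕜^{p|q}`: tuples of `p` even and `q` odd supernumbers, normed by the sum of
the norms of the entries. -/
def superModel (𝕜 : Type*) [RCLike 𝕜] (p q : ℕ) :
    Submodule 𝕜 (PiLp 1 fun _ : Fin p ⊕ Fin q => Supernumber 𝕜) where
  carrier := {z | ∀ A, z A ∈ Supernumber.ofParity 𝕜 (indexParity A)}
  add_mem' := fun hz hw A => Submodule.add_mem _ (hz A) (hw A)
  zero_mem' := fun A => Submodule.zero_mem (Supernumber.ofParity 𝕜 (indexParity A))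
  smul_mem' := fun c _ hz A => Submodule.smul_mem _ c (hz A)

section

variable {𝕜 : Type*} [RCLike 𝕜] {p q : ℕ}

/-- `φ (a + h) = φ a + ∑ A, h^A c_A + o(‖h‖)`: the supernumbers `c_A` are values at `a` of
the super partial derivatives `G_A φ`. -/
def HasSuperPartials (φ : superModel 𝕜 p q → Supernumber 𝕜) (c : Fin p ⊕ Fin q → Supernumber 𝕜)
    (a : superModel 𝕜 p q) : Prop :=
  (fun h : superModel 𝕜 p q => φ (a + h) - φ a - ∑ A, h.1 A * c A) =o[𝓝 0] fun h => h

/-- Functions of class `G^s` on `𝕜^{p|q}`. -/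
def IsG : ℕ → (superModel 𝕜 p q → Supernumber 𝕜) → Prop
  | 0, φ => Continuous φ
  | 1, φ => ∃ G : Fin p ⊕ Fin q → superModel 𝕜 p q → Supernumber 𝕜,
      ∀ a, HasSuperPartials φ (fun A => G A a) a
  | s + 2, φ => ∃ G : Fin p ⊕ Fin q → superModel 𝕜 p q → Supernumber 𝕜,
      (∀ a, HasSuperPartials φ (fun A => G A a) a) ∧ ∀ A, IsG (s + 1) (G A)

open Classical in
/-- The super partial derivative `G_A φ` at `a` (with value `0` if `φ` has none). -/
def superPartial (φ : superModel 𝕜 p q → Supernumber 𝕜) (A : Fin p ⊕ Fin q)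
    (a : superModel 𝕜 p q) : Supernumber 𝕜 :=
  if h : ∃ c, HasSuperPartials φ c a then h.choose A else 0

end

/-! ### Charts, components and higher derivatives on `𝔤⁰` -/

section

variable {𝕜 : Type*} [RCLike 𝕜] {p q : ℕ}
  {V : Type*} [NormedAddCommGroup V] [NormedSpace 𝕜 V] [Module (Supernumber 𝕜) V]
  [BanachSuperSpace 𝕜 V]

/-- The component `v^A` of `v` relative to a pure basis. -/
def PureBasis.component (e : PureBasis 𝕜 p q V) (v : V) (A : Fin p ⊕ Fin q) : Supernumber 𝕜 :=
  e.toBasis.repr v A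

/-- The components of an even vector have the parity of their index. -/
theorem PureBasis.component_mem (e : PureBasis 𝕜 p q V) (v : evenPart 𝕜 V) (A : Fin p ⊕ Fin q) :
    e.component v A ∈ Supernumber.ofParity 𝕜 (indexParity A) := by
  choose a ha b hb hab using fun A =>
    Supernumber.exists_parity_add (indexParity A) (e.component (v : V) A)
  have hv : ∑ A, e.component (v : V) A • e.toBasis A = v := e.toBasis.sum_repr v
  have h0 : ∑ A, a A • e.toBasis A ∈ evenPart 𝕜 V := Submodule.sum_mem _ fun A _ => by
    have h := BanachSuperSpace.smul_mem_grade (ha A) (e.pure A)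
    rwa [CharTwo.add_self_eq_zero] at h
  have h1 : ∑ A, b A • e.toBasis A ∈ BanachSuperSpace.grade (𝕜 := 𝕜) (V := V) 1 :=
    Submodule.sum_mem _ fun A _ => by
      have h := BanachSuperSpace.smul_mem_grade (hb A) (e.pure A)
      rwa [add_assoc, CharTwo.add_self_eq_zero, add_zero] at h
  have hsum : ∑ A, a A • e.toBasis A + ∑ A, b A • e.toBasis A = v := by
    rw [← Finset.sum_add_distrib, ← hv]
    exact Finset.sum_congr rfl fun A _ => by rw [← add_smul, hab]
  have h1' : ∑ A, b A • e.toBasis A ∈ evenPart 𝕜 V := by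
    have := Submodule.sub_mem _ v.2 h0
    rwa [← hsum, add_sub_cancel_left] at this
  have hz : ∑ A, b A • e.toBasis A = 0 :=
    Submodule.disjoint_def.1 (BanachSuperSpace.isCompl_grade (𝕜 := 𝕜) (V := V)).disjoint _ h1' h1
  have hb0 := Fintype.linearIndependent_iff.1 e.toBasis.linearIndependent b hz A
  rw [← hab A, hb0, add_zero]
  exact ha A

/-- The global chart `x ↦ (u^A(x))` of `V⁰` given by a pure basis, with `x = ∑ A, u^A(x) e_A`. -/
def PureBasis.chart (e : PureBasis 𝕜 p q V) (x : evenPart 𝕜 V) : superModel 𝕜 p q :=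
  ⟨WithLp.toLp 1 fun A => e.component x A, fun A => e.component_mem x A⟩

/-- The inverse `(z^A) ↦ ∑ A, z^A e_A` of the global chart. -/
def PureBasis.chartInv (e : PureBasis 𝕜 p q V) (z : superModel 𝕜 p q) : evenPart 𝕜 V :=
  ⟨∑ A, z.1 A • e.toBasis A, Submodule.sum_mem _ fun A _ => by
    have h := BanachSuperSpace.smul_mem_grade (z.2 A) (e.pure A)
    rwa [CharTwo.add_self_eq_zero] at h⟩

theorem PureBasis.chart_chartInv (e : PureBasis 𝕜 p q V) (z : superModel 𝕜 p q) :
    e.chart (e.chartInv z) = z := by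
  refine Subtype.ext (PiLp.ext fun A => ?_)
  exact congrFun (e.toBasis.repr_sum_self fun A => z.1 A) A

theorem PureBasis.chartInv_chart (e : PureBasis 𝕜 p q V) (x : evenPart 𝕜 V) :
    e.chartInv (e.chart x) = x :=
  Subtype.ext (e.toBasis.sum_repr (x : V))

/-- The super partial derivative `∂φ/∂u^A` at `x`, where the `u^A` are the coordinates on `V⁰`
given by a pure basis. -/
def coordPartial (e : PureBasis 𝕜 p q V) (φ : evenPart 𝕜 V → Supernumber 𝕜) (A : Fin p ⊕ Fin q)
    (x : evenPart 𝕜 V) : Supernumber 𝕜 :=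
  superPartial (fun z => φ (e.chartInv z)) A (e.chart x)

open Classical in
/-- The differential `d_x φ : V → Λ` of `φ : V⁰ → Λ`, the tangent module of `V⁰` at `x` being
identified with `V` by `∂/∂u^A ↦ e_A`. On even vectors it is the Fréchet derivative over `𝔽`; a
general vector `X = ∑ A, X^A e_A` acts by `X(φ) = ∑ A, X^A ∂φ/∂u^A`, and the two agree on even
vectors where `φ` has super partial derivatives. -/
def superDeriv (𝔽 : Type*) [RCLike 𝔽] [NormedAlgebra 𝔽 𝕜] [NormedSpace 𝔽 V] [IsScalarTower 𝔽 𝕜 V]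
    (e : PureBasis 𝕜 p q V) (φ : evenPart 𝕜 V → Supernumber 𝕜) (x : evenPart 𝕜 V) (X : V) :
    Supernumber 𝕜 :=
  if hX : X ∈ evenPart 𝕜 V then fderiv 𝔽 φ x ⟨X, hX⟩
  else ∑ A, e.component X A * coordPartial e φ A x

/-- The higher derivatives: `d⁰_x φ = φ x` and
`d^{k+1}_x φ (X₁, …, X_{k+1}) = d_x [y ↦ d^k_y φ (X₂, …, X_{k+1})] (X₁)`. -/
def iterSuperDeriv (𝔽 : Type*) [RCLike 𝔽] [NormedAlgebra 𝔽 𝕜] [NormedSpace 𝔽 V]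
    [IsScalarTower 𝔽 𝕜 V] (e : PureBasis 𝕜 p q V) (φ : evenPart 𝕜 V → Supernumber 𝕜) :
    (k : ℕ) → evenPart 𝕜 V → (Fin k → V) → Supernumber 𝕜
  | 0, x, _ => φ x
  | k + 1, x, X => superDeriv 𝔽 e (fun y => iterSuperDeriv 𝔽 e φ k y (Fin.tail X)) x (X 0)

end

section

variable {𝕜 : Type*} [RCLike 𝕜]
  {V : Type*} [NormedAddCommGroup V] [NormedSpace 𝕜 V] [Module (Supernumber 𝕜) V]
  [BanachSuperSpace 𝕜 V] {W : Type*} [NormedAddCommGroup W] [NormedSpace 𝕜 W]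
  [Module (Supernumber 𝕜) W] [BanachSuperSpace 𝕜 W] {p q r s : ℕ}

/-- A map `V⁰ → W⁰` is `G^∞` if, in the global charts given by pure bases of `V` and `W`, each of
its components is of class `G^l` for every `l ≥ 1`. -/
def IsGInfty (e : PureBasis 𝕜 p q V) (e' : PureBasis 𝕜 r s W)
    (f : evenPart 𝕜 V → evenPart 𝕜 W) : Prop :=
  ∀ (B : Fin r ⊕ Fin s) (l : ℕ), 1 ≤ l →
    IsG l fun z : superModel 𝕜 p q => (e'.chart (f (e.chartInv z))).1 B

/-- `β : V^k → Λ` is multilinear over `V⁰`: for some pure basis `e` of `V`,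
`β (v₁, …, v_k) = ∑ v₁^{A₁} ⋯ v_k^{A_k} β (e_{A_k}, …, e_{A₁})` for all even `v₁, …, v_k`. -/
def IsMultilinearOverEven (𝕜 : Type*) {V : Type*} [RCLike 𝕜] [NormedAddCommGroup V]
    [NormedSpace 𝕜 V] [Module (Supernumber 𝕜) V] [BanachSuperSpace 𝕜 V] {k : ℕ}
    (β : (Fin k → V) → Supernumber 𝕜) : Prop :=
  ∃ (p q : ℕ) (e : PureBasis 𝕜 p q V), ∀ v : Fin k → evenPart 𝕜 V,
    β (fun i => v i) = ∑ A : Fin k → Fin p ⊕ Fin q,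
      (List.ofFn fun i => e.component (v i) (A i)).prod * β (fun i => e.toBasis (A i.rev))

end

end

namespace Supernumber

noncomputable section

variable {𝕜 : Type*} [RCLike 𝕜]

/-! In a pure basis, being `G^1` means that the Fréchet derivative has the form `h ↦ ∑ h^B c_B`. The
question is therefore whether all iterated derivatives are sums `∑ v₁^{A₁} ⋯ v_k^{A_k} c_A`
(`superForm`), and whether the coefficients `c_A` are themselves differentiable in this sense.

Everything rests on having infinitely many generators. A supernumber is, up to arbitrarily small
error, supported on finitely many `I`, and some `ζ^n` avoids them all, so `‖z‖ ≤ sup_n ‖ζ^n z‖`. Odd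
coordinates only see coefficients multiplied by odd supernumbers, yet by this estimate they still
determine the coefficients and control their norms.

If `φ` is `G^∞`, its partials are unique, hence again `G^∞`. Differentiating the `k`-th form puts
the new component next to the coefficient, in the last slot; symmetry of the Fréchet derivatives
moves it to the first (`iteratedFDeriv_eq_superForm`).

Conversely, a basis that varies with `x` and `k` is first replaced by the fixed one
(`exists_superForm_eq`). Evaluating the forms at the vectors `e_A` and `ζ^n e_A` then bounds the
Taylor remainder of each coefficient by that of the whole derivative. So the coefficients of order
`k` have those of order `k + 1` as partials (`hasFDerivAt_coeff`), and induction gives every class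
`G^l`. -/

instance {𝔽 : Type*} [NormedField 𝔽] [NormedAlgebra 𝔽 𝕜] :
    IsScalarTower 𝔽 (Supernumber 𝕜) (Supernumber 𝕜) :=
  ⟨fun c z w => by
    ext I
    simp only [smul_eq_mul, coeff_mul, coeff_smul, Finset.smul_sum]
    exact Finset.sum_congr rfl fun J _ => by simp⟩

instance {𝔽 : Type*} [NormedField 𝔽] [NormedAlgebra 𝔽 𝕜] :
    SMulCommClass 𝔽 (Supernumber 𝕜) (Supernumber 𝕜) :=
  ⟨fun c z w => by
    ext I
    simp only [smul_eq_mul, coeff_mul, coeff_smul, Finset.smul_sum]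
    exact Finset.sum_congr rfl fun J _ => by simp⟩

instance {𝔽 : Type*} [NormedField 𝔽] [NormedAlgebra 𝔽 𝕜] :
    IsScalarTower 𝔽 𝕜 (Supernumber 𝕜) :=
  ⟨fun c d z => by ext I; simp⟩

/-! ### Supercommutativity -/

/-- By disjointness, each pair in `J ×ˢ K` is out of order in exactly one of the words `ζ^J ζ^K` and
`ζ^K ζ^J`. -/
theorem inversions_add_inversions {J K : Finset ℕ} (h : Disjoint J K) :
    inversions J K + inversions K J = J.card * K.card := by
  have h1 : inversions K J = ((J ×ˢ K).filter fun x => ¬ x.2 < x.1).card := by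
    unfold inversions
    refine Finset.card_bij' (fun x _ => x.swap) (fun x _ => x.swap) ?_ ?_ ?_ ?_
    · rintro ⟨a, b⟩ hx
      simp only [Finset.mem_filter, Finset.mem_product, Prod.swap] at hx ⊢
      exact ⟨hx.1.symm, not_lt.2 hx.2.le⟩
    · rintro ⟨a, b⟩ hx
      simp only [Finset.mem_filter, Finset.mem_product, Prod.swap, not_lt] at hx ⊢
      exact ⟨hx.1.symm, lt_of_le_of_ne hx.2 fun hab =>
        Finset.disjoint_left.1 h hx.1.1 (hab ▸ hx.1.2)⟩
    · simp
    · simp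
  rw [h1, inversions, Finset.card_filter_add_card_filter_not, Finset.card_product]

theorem neg_one_pow_natCast_val (n m : ℕ) (δ ε : ZMod 2) (hn : (n : ZMod 2) = δ)
    (hm : (m : ZMod 2) = ε) : (-1 : 𝕜) ^ (n * m) = (-1) ^ (δ.val * ε.val) := by
  subst hn hm
  rw [ZMod.val_natCast, ZMod.val_natCast, neg_one_pow_eq_pow_mod_two,
    neg_one_pow_eq_pow_mod_two (n := n % 2 * (m % 2)), ← Nat.mul_mod]

/-- The terms of the two products match under `J ↦ I \ J`, and the signs differ by `(-1)^(|J| |I \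
J|)`. The sign is carried by `a`, so that the factor that has moved keeps its parity and can be
moved again. -/
theorem mul_comm_of_parity {δ ε : ZMod 2} {a b : Supernumber 𝕜} (ha : a ∈ ofParity 𝕜 δ)
    (hb : b ∈ ofParity 𝕜 ε) : a * b = b * ((-1 : 𝕜) ^ (δ.val * ε.val) • a) := by
  ext I
  simp only [coeff_mul, coeff_smul]
  refine Finset.sum_bij' (fun J _ => I \ J) (fun J _ => I \ J) ?_ ?_ ?_ ?_ ?_
  · simp
  · simp
  · intro J hJ
    simp [Finset.inter_eq_right.2 (Finset.mem_powerset.1 hJ)]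
  · intro J hJ
    simp [Finset.inter_eq_right.2 (Finset.mem_powerset.1 hJ)]
  · intro J hJ
    have hJ' : I \ (I \ J) = J := by
      simp [Finset.inter_eq_right.2 (Finset.mem_powerset.1 hJ)]
    rw [hJ']
    by_cases h1 : (J.card : ZMod 2) = δ
    · by_cases h2 : ((I \ J).card : ZMod 2) = ε
      · rw [← neg_one_pow_natCast_val _ _ δ ε h1 h2,
          ← inversions_add_inversions Finset.disjoint_sdiff, pow_add, smul_eq_mul]
        have : (-1 : 𝕜) ^ inversions (I \ J) J * (-1 : 𝕜) ^ inversions (I \ J) J = 1 := by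
          rw [← mul_pow]; simp
        linear_combination (-(-1 : 𝕜) ^ inversions J (I \ J) * a.coeff J * b.coeff (I \ J)) * this
      · simp [hb _ h2]
    · simp [ha _ h1]

/-! ### Generators -/

/-- The generator `ζ^n`. -/
def generator (𝕜 : Type*) [RCLike 𝕜] (n : ℕ) : Supernumber 𝕜 :=
  ofCoeff (fun I => if I = {n} then 1 else 0) <|
    summable_of_ne_finset_zero (s := {{n}}) fun I hI => by
      simp only [Finset.mem_singleton] at hI
      simp [hI]

theorem coeff_generator (n : ℕ) (I : Finset ℕ) :
    (generator 𝕜 n).coeff I = if I = {n} then 1 else 0 := rfl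

theorem generator_mem_ofParity (n : ℕ) : generator 𝕜 n ∈ ofParity 𝕜 1 := fun I hI => by
  rw [coeff_generator, if_neg]
  rintro rfl
  simp at hI

theorem one_mem_ofParity : (1 : Supernumber 𝕜) ∈ ofParity 𝕜 0 := fun I hI => by
  rw [coeff_one, if_neg]
  rintro rfl
  simp at hI

theorem norm_generator (n : ℕ) : ‖generator 𝕜 n‖ = 1 := by
  rw [norm_eq_tsum, tsum_eq_single {n}]
  · simp [coeff_generator]
  · intro I hI
    simp [coeff_generator, hI]

theorem norm_one : ‖(1 : Supernumber 𝕜)‖ = 1 := by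
  rw [norm_eq_tsum, tsum_eq_single ∅]
  · simp [coeff_one]
  · intro I hI
    simp [coeff_one, hI]

/-- On the monomials not containing `ζ^n`, multiplication by `ζ^n` is an injective relabelling up to
sign. -/
theorem norm_coeff_generator_mul {n : ℕ} {I : Finset ℕ} (h : n ∉ I) (z : Supernumber 𝕜) :
    ‖(generator 𝕜 n * z).coeff (insert n I)‖ = ‖z.coeff I‖ := by
  rw [coeff_mul, Finset.sum_eq_single {n}]
  · have : insert n I \ {n} = I := by
      ext x
      simp only [Finset.mem_sdiff, Finset.mem_insert, Finset.mem_singleton]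
      grind
    simp [coeff_generator, this]
  · intro J _ hJ
    simp [coeff_generator, hJ]
  · simp

/-- Each finite partial sum of `‖z‖` survives multiplication by a generator outside all its index
sets. This is where the supply of generators must be infinite: with finitely many, the top monomial
is killed by all of them. -/
theorem norm_le_of_generator_mul {z : Supernumber 𝕜} {C : ℝ}
    (h : ∀ n, ‖generator 𝕜 n * z‖ ≤ C) : ‖z‖ ≤ C := by
  rw [norm_eq_tsum]
  refine z.summable_norm_coeff.tsum_le_of_sum_le fun s => ?_
  obtain ⟨n, hn⟩ := Infinite.exists_notMem_finset (s.biUnion id)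
  have hn' : ∀ I ∈ s, n ∉ I := fun I hI hnI => hn (Finset.mem_biUnion.2 ⟨I, hI, hnI⟩)
  refine le_trans ?_ (h n)
  rw [norm_eq_tsum, Finset.sum_congr rfl fun I hI => (norm_coeff_generator_mul (hn' I hI) z).symm,
    ← Finset.sum_image (f := fun I => ‖(generator 𝕜 n * z).coeff I‖) (g := insert n)]
  · exact (summable_norm_coeff _).sum_le_tsum _ fun _ _ => norm_nonneg _
  · intro I hI J hJ hIJ
    rw [← Finset.erase_insert (hn' I hI), ← Finset.erase_insert (hn' J hJ)]
    exact congrArg (fun K => K.erase n) hIJ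

theorem mem_ofParity_of_generator_mul {z : Supernumber 𝕜} {ε : ZMod 2}
    (h : ∀ n, generator 𝕜 n * z ∈ ofParity 𝕜 ε) : z ∈ ofParity 𝕜 (ε + 1) := fun I hI => by
  obtain ⟨n, hn⟩ := Infinite.exists_notMem_finset I
  rw [← norm_eq_zero, ← norm_coeff_generator_mul hn, norm_eq_zero]
  refine h n _ fun hc => hI ?_
  rw [Finset.card_insert_of_notMem hn] at hc
  rw [← hc]
  push_cast
  rw [add_assoc, CharTwo.add_self_eq_zero, add_zero]

/-- A supernumber of the parity of `A`: `1` for an even index and `ζ^n` for an odd one. -/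
def probe (𝕜 : Type*) [RCLike 𝕜] {p q : ℕ} (A : Fin p ⊕ Fin q) (n : ℕ) : Supernumber 𝕜 :=
  Sum.elim (fun _ => 1) (fun _ => generator 𝕜 n) A

theorem probe_mem_ofParity {p q : ℕ} (A : Fin p ⊕ Fin q) (n : ℕ) :
    probe 𝕜 A n ∈ ofParity 𝕜 (indexParity A) := by
  cases A
  · exact one_mem_ofParity
  · exact generator_mem_ofParity n

theorem norm_probe {p q : ℕ} (A : Fin p ⊕ Fin q) (n : ℕ) : ‖probe 𝕜 A n‖ = 1 := by
  cases A
  · exact norm_one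
  · exact norm_generator n

theorem norm_le_of_probe_mul {p q : ℕ} {A : Fin p ⊕ Fin q} {z : Supernumber 𝕜} {C : ℝ}
    (h : ∀ n, ‖probe 𝕜 A n * z‖ ≤ C) : ‖z‖ ≤ C := by
  cases A
  · simpa [probe] using h 0
  · exact norm_le_of_generator_mul h

theorem mem_ofParity_of_probe_mul {p q : ℕ} {A : Fin p ⊕ Fin q} {z : Supernumber 𝕜} {ε : ZMod 2}
    (h : ∀ n, probe 𝕜 A n * z ∈ ofParity 𝕜 ε) : z ∈ ofParity 𝕜 (ε + indexParity A) := by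
  cases A
  · simpa [probe, indexParity] using h 0
  · exact mem_ofParity_of_generator_mul h

theorem norm_le_of_prod_probe_mul {p q k : ℕ} (A : Fin k → Fin p ⊕ Fin q) {z : Supernumber 𝕜}
    {C : ℝ} (h : ∀ n : Fin k → ℕ, ‖(List.ofFn fun i => probe 𝕜 (A i) (n i)).prod * z‖ ≤ C) :
    ‖z‖ ≤ C := by
  induction k with
  | zero => simpa using h Fin.elim0
  | succ k ih =>
    refine ih (fun i => A i.succ) fun n => norm_le_of_probe_mul (A := A 0) fun m => ?_
    simpa [List.ofFn_succ, mul_assoc] using h (Fin.cons m n)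

/-- A supernumber of pure parity moves past a product of factors of given parities at the cost of
a change of sign that does not depend on the factors. -/
theorem exists_mul_prod_eq_prod_mul {k : ℕ} (ε : Fin k → ZMod 2) {δ : ZMod 2} {t : Supernumber 𝕜}
    (ht : t ∈ ofParity 𝕜 δ) : ∃ t' : Supernumber 𝕜, ∀ u : Fin k → Supernumber 𝕜,
      (∀ i, u i ∈ ofParity 𝕜 (ε i)) → t * (List.ofFn u).prod = (List.ofFn u).prod * t' := by
  induction k generalizing t with
  | zero => exact ⟨t, fun u _ => by simp⟩
  | succ k ih =>
    obtain ⟨t', ht'⟩ := ih (fun i => ε i.succ)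
      (Submodule.smul_mem _ ((-1 : 𝕜) ^ (δ.val * (ε 0).val)) ht)
    refine ⟨t', fun u hu => ?_⟩
    rw [List.ofFn_succ, List.prod_cons, ← mul_assoc, mul_comm_of_parity ht (hu 0), mul_assoc,
      ht' _ fun i => hu i.succ, mul_assoc]

end

end Supernumber

/-! ### Symmetry of iterated Fréchet derivatives -/

section

variable {𝔽 E F : Type*} [RCLike 𝔽] [NormedAddCommGroup E] [NormedSpace 𝔽 E]
  [NormedAddCommGroup F] [NormedSpace 𝔽 F]

theorem fderiv_iteratedFDeriv_apply {φ : E → F} (hφ : ContDiff 𝔽 ∞ φ) (k : ℕ) (x h : E)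
    (v : Fin k → E) :
    fderiv 𝔽 (fun y => iteratedFDeriv 𝔽 k φ y v) x h =
      iteratedFDeriv 𝔽 (k + 1) φ x (Fin.cons h v) := by
  rw [fderiv_continuousMultilinear_apply_const_apply
    ((hφ.differentiable_iteratedFDeriv (mod_cast ENat.natCast_lt_top k)) x),
    iteratedFDeriv_succ_apply_left, Fin.cons_zero, Fin.tail_cons]

theorem iteratedFDeriv_cons_cons_comm {φ : E → F} (hφ : ContDiff 𝔽 ∞ φ) (k : ℕ) (x a b : E)
    (v : Fin k → E) :
    iteratedFDeriv 𝔽 (k + 2) φ x (Fin.cons a (Fin.cons b v)) =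
      iteratedFDeriv 𝔽 (k + 2) φ x (Fin.cons b (Fin.cons a v)) := by
  have hD : ContDiff 𝔽 ∞ (iteratedFDeriv 𝔽 k φ) := hφ.iteratedFDeriv_right (mod_cast le_top)
  have hD' : ContDiff 𝔽 ∞ (fderiv 𝔽 (iteratedFDeriv 𝔽 k φ)) := hD.fderiv_right (by simp)
  have key : ∀ a b, iteratedFDeriv 𝔽 (k + 2) φ x (Fin.cons a (Fin.cons b v)) =
      fderiv 𝔽 (fderiv 𝔽 (iteratedFDeriv 𝔽 k φ)) x a b v := fun a b => by
    have hd : DifferentiableAt 𝔽 (fderiv 𝔽 (iteratedFDeriv 𝔽 k φ)) x :=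
      hD'.differentiable (by simp) x
    rw [← fderiv_iteratedFDeriv_apply hφ]
    simp only [iteratedFDeriv_succ_apply_left, Fin.cons_zero, Fin.tail_cons]
    rw [fderiv_continuousMultilinear_apply_const_apply
      (hd.clm_apply (differentiableAt_const b)), fderiv_clm_apply hd (differentiableAt_const b)]
    simp
  have hs : IsSymmSndFDerivAt 𝔽 (iteratedFDeriv 𝔽 k φ) x :=
    hD.contDiffAt.isSymmSndFDerivAt (by
      rw [minSmoothness_of_isRCLikeNormedField]; exact WithTop.coe_le_coe.2 (le_top : (2 : ℕ∞) ≤ ⊤))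
  rw [key, key, hs.eq]

/-- `h` is swapped with the first entry of `v`; the induction hypothesis, valid at every point, is
then differentiated along that entry. -/
theorem iteratedFDeriv_cons_eq_snoc {φ : E → F} (hφ : ContDiff 𝔽 ∞ φ) (k : ℕ) (x h : E)
    (v : Fin k → E) :
    iteratedFDeriv 𝔽 (k + 1) φ x (Fin.cons h v) =
      iteratedFDeriv 𝔽 (k + 1) φ x (Fin.snoc (α := fun _ => E) v h) := by
  induction k generalizing x with
  | zero =>
    congr 1
    ext i
    fin_cases i
    rfl
  | succ k ih =>
    rw [← Fin.cons_self_tail v, iteratedFDeriv_cons_cons_comm hφ,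
      ← fderiv_iteratedFDeriv_apply hφ, funext fun y => ih y (Fin.tail v),
      fderiv_iteratedFDeriv_apply hφ, Fin.cons_snoc_eq_snoc_cons]

end

/-! ### Components and charts as continuous linear maps -/

namespace PureBasis

noncomputable section

variable {𝕜 : Type*} [RCLike 𝕜] {p q : ℕ}
  {V : Type*} [NormedAddCommGroup V] [NormedSpace 𝕜 V] [Module (Supernumber 𝕜) V]
  [BanachSuperSpace 𝕜 V] (e : PureBasis 𝕜 p q V)

theorem smul_eq_supernumber_smul {𝔽 : Type*} [RCLike 𝔽] [NormedAlgebra 𝔽 𝕜] [NormedSpace 𝔽 V]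
    [IsScalarTower 𝔽 𝕜 V] (c : 𝔽) (v : V) : c • v = (c • (1 : Supernumber 𝕜)) • v := by
  rw [← smul_one_smul 𝕜 c v, ← smul_one_smul 𝕜 c (1 : Supernumber 𝕜),
    ← smul_one_smul (Supernumber 𝕜) (c • (1 : 𝕜)) v]

theorem component_smul {𝔽 : Type*} [RCLike 𝔽] [NormedAlgebra 𝔽 𝕜] [NormedSpace 𝔽 V]
    [IsScalarTower 𝔽 𝕜 V] (c : 𝔽) (v : V) (A : Fin p ⊕ Fin q) :
    e.component (c • v) A = c • e.component v A := by
  rw [smul_eq_supernumber_smul (𝕜 := 𝕜), component, map_smul, Finsupp.smul_apply, smul_eq_mul,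
    smul_mul_assoc, one_mul, component]

theorem component_add (v w : V) (A : Fin p ⊕ Fin q) :
    e.component (v + w) A = e.component v A + e.component w A := by
  simp [component]

/-- The linear combinations of a pure basis, as a linear map. -/
def combL : (Fin p ⊕ Fin q → Supernumber 𝕜) ≃ₗ[𝕜] V where
  toFun z := ∑ A, z A • e.toBasis A
  invFun v A := e.component v A
  map_add' z w := by simp [add_smul, Finset.sum_add_distrib]
  map_smul' c z := by simp [Finset.smul_sum]
  left_inv z := funext fun A => congrFun (e.toBasis.repr_sum_self z) A
  right_inv v := e.toBasis.sum_repr v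

/-- The open mapping theorem applies: forming linear combinations is a continuous linear bijection
between Banach spaces. -/
theorem continuous_component (A : Fin p ⊕ Fin q) : Continuous fun v : V => e.component v A := by
  have : CompleteSpace V := BanachSuperSpace.toCompleteSpace (𝕜 := 𝕜)
  have : ContinuousSMul (Supernumber 𝕜) V := BanachSuperSpace.toContinuousSMul (𝕜 := 𝕜)
  have h : Continuous (combL e) := by
    change Continuous fun z : Fin p ⊕ Fin q → Supernumber 𝕜 => ∑ A, z A • e.toBasis A
    fun_prop
  exact (continuous_apply A).comp (e.combL.continuous_symm h)

/-- A component, as a continuous linear functional. -/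
def componentL (𝔽 : Type*) [RCLike 𝔽] [NormedAlgebra 𝔽 𝕜] [NormedSpace 𝔽 V]
    [IsScalarTower 𝔽 𝕜 V] (A : Fin p ⊕ Fin q) : V →L[𝔽] Supernumber 𝕜 where
  toFun v := e.component v A
  map_add' v w := e.component_add v w A
  map_smul' c v := e.component_smul c v A
  cont := e.continuous_component A

/-- The global chart, as a linear equivalence. -/
def chartL : evenPart 𝕜 V ≃L[𝕜] superModel 𝕜 p q where
  toFun := e.chart
  invFun := e.chartInv
  map_add' x y := Subtype.ext (PiLp.ext fun A => e.component_add x y A)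
  map_smul' c x := Subtype.ext (PiLp.ext fun A => e.component_smul c (x : V) A)
  left_inv := e.chartInv_chart
  right_inv := e.chart_chartInv
  continuous_toFun := by
    refine Continuous.subtype_mk ((PiLp.continuous_toLp 1 _).comp ?_) _
    exact continuous_pi fun A => (e.continuous_component A).comp continuous_subtype_val
  continuous_invFun := by
    have : ContinuousSMul (Supernumber 𝕜) V := BanachSuperSpace.toContinuousSMul (𝕜 := 𝕜)
    refine Continuous.subtype_mk (continuous_finsetSum _ fun A _ => ?_) _
    exact Continuous.smul ((PiLp.continuous_apply 1 _ A).comp continuous_subtype_val)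
      continuous_const

variable {𝔽 : Type*} [RCLike 𝔽] [NormedAlgebra 𝔽 𝕜] [NormedSpace 𝔽 V] [IsScalarTower 𝔽 𝕜 V]

/-- The continuous linear map `h ↦ ∑ A, h^A c_A` on the even part. -/
def sumComponentMulL (𝔽 : Type*) [RCLike 𝔽] [NormedAlgebra 𝔽 𝕜] [NormedSpace 𝔽 V]
    [IsScalarTower 𝔽 𝕜 V] (c : Fin p ⊕ Fin q → Supernumber 𝕜) :
    evenPart 𝕜 V →L[𝔽] Supernumber 𝕜 where
  toFun h := ∑ A, e.component (h : V) A * c A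
  map_add' h h' := by simp [component_add, add_mul, Finset.sum_add_distrib]
  map_smul' a h := by
    rw [RingHom.id_apply, Finset.smul_sum]
    exact Finset.sum_congr rfl fun A _ => by
      rw [← smul_mul_assoc, ← component_smul]; rfl
  cont := continuous_finsetSum _ fun A _ =>
    ((e.continuous_component A).comp continuous_subtype_val).mul continuous_const

theorem sumComponentMulL_apply (c : Fin p ⊕ Fin q → Supernumber 𝕜) (h : evenPart 𝕜 V) :
    e.sumComponentMulL 𝔽 c h = ∑ A, e.component (h : V) A * c A := rfl

/-- The chart is a linear homeomorphism, so it preserves remainders of order `o(‖h‖)`. The left side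
does not involve `𝔽`, which lets real and complex derivatives be treated together. -/
theorem hasSuperPartials_iff_hasFDerivAt (φ : evenPart 𝕜 V → Supernumber 𝕜)
    (c : Fin p ⊕ Fin q → Supernumber 𝕜) (x : evenPart 𝕜 V) :
    HasSuperPartials (fun z => φ (e.chartInv z)) c (e.chart x) ↔
      HasFDerivAt φ (e.sumComponentMulL 𝔽 c) x := by
  rw [hasFDerivAt_iff_isLittleO_nhds_zero, HasSuperPartials]
  have h0 : Filter.Tendsto e.chartL (𝓝 0) (𝓝 0) := by
    simpa using e.chartL.continuous.tendsto 0
  have h0' : Filter.Tendsto e.chartL.symm (𝓝 0) (𝓝 0) := by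
    simpa using e.chartL.symm.continuous.tendsto 0
  have hadd : ∀ h, e.chartInv (e.chart x + h) = x + e.chartL.symm h := fun h => by
    change e.chartL.symm (e.chartL x + h) = _
    rw [map_add, e.chartL.symm_apply_apply]
  constructor
  · intro h
    refine ((h.comp_tendsto h0).trans_isBigO (ContinuousLinearMap.isBigO_id
      (e.chartL : evenPart 𝕜 V →L[𝕜] superModel 𝕜 p q) _)).congr_left
      fun y => ?_
    simp only [Function.comp, hadd, e.chartL.symm_apply_apply, e.chartInv_chart]
    rfl
  · intro h
    refine ((h.comp_tendsto h0').trans_isBigO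
      (ContinuousLinearMap.isBigO_id
      (e.chartL.symm : superModel 𝕜 p q →L[𝕜] evenPart 𝕜 V) _)).congr_left fun y => ?_
    simp only [Function.comp, hadd, e.chartInv_chart]
    exact congrArg (fun t => φ (x + e.chartL.symm y) - φ x - t)
      (congrArg (fun z : superModel 𝕜 p q => ∑ A, z.1 A * c A) (e.chart_chartInv y))

/-- The even vector `e_A` or `ζ^n e_A`, according to the parity of `A`. -/
def probeVector (A : Fin p ⊕ Fin q) (n : ℕ) : evenPart 𝕜 V :=
  ⟨Supernumber.probe 𝕜 A n • e.toBasis A, by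
    have h := BanachSuperSpace.smul_mem_grade (Supernumber.probe_mem_ofParity A n) (e.pure A)
    rwa [CharTwo.add_self_eq_zero] at h⟩

theorem component_basis (A B : Fin p ⊕ Fin q) :
    e.component (e.toBasis A) B = if A = B then 1 else 0 := by
  classical
  simp [component, Finsupp.single_apply]

theorem component_supernumber_smul (a : Supernumber 𝕜) (v : V) (B : Fin p ⊕ Fin q) :
    e.component (a • v) B = a * e.component v B := by
  simp [component]

theorem component_probeVector (A B : Fin p ⊕ Fin q) (n : ℕ) :
    e.component (e.probeVector A n : V) B = if A = B then Supernumber.probe 𝕜 A n else 0 := by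
  simp [probeVector, component_supernumber_smul, component_basis]

/-- The map `z ↦ z • e_A` is bounded and every `probe` has norm `1`; the uniformity in `n` is what
the remainder estimate for the coefficients needs. -/
theorem exists_norm_probeVector_le : ∃ M : ℝ, 0 ≤ M ∧ ∀ A n, ‖e.probeVector A n‖ ≤ M := by
  have : ContinuousSMul (Supernumber 𝕜) V := BanachSuperSpace.toContinuousSMul (𝕜 := 𝕜)
  have h : ∀ A, ∃ C : ℝ, 0 < C ∧ ∀ n, ‖e.probeVector A n‖ ≤ C := fun A => by
    let T : Supernumber 𝕜 →L[𝕜] V :=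
      { toFun := fun z => z • e.toBasis A
        map_add' := fun z w => add_smul z w _
        map_smul' := fun c z => smul_assoc c z _
        cont := continuous_id.smul continuous_const }
    obtain ⟨C, hC, hT⟩ := T.bound
    refine ⟨C, hC, fun n => (hT _).trans (le_of_eq ?_)⟩
    rw [Supernumber.norm_probe, mul_one]
  choose C hC hCn using h
  exact ⟨∑ A, C A, Finset.sum_nonneg fun A _ => (hC A).le, fun A n => (hCn A n).trans
    (Finset.single_le_sum (fun B _ => (hC B).le) (Finset.mem_univ A))⟩

/-! ### Uniqueness of super partial derivatives -/

theorem sumComponentMulL_injective :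
    Function.Injective (e.sumComponentMulL 𝔽 : _ → evenPart 𝕜 V →L[𝔽] Supernumber 𝕜) := by
  intro c c' h
  ext1 A
  rw [← sub_eq_zero, ← norm_le_zero_iff]
  refine Supernumber.norm_le_of_probe_mul (A := A) fun n => le_of_eq ?_
  have h1 := DFunLike.congr_fun h (e.probeVector A n)
  simp only [sumComponentMulL_apply, component_probeVector, ite_mul, zero_mul,
    Finset.sum_ite_eq, Finset.mem_univ, if_true] at h1
  rw [mul_sub, h1, sub_self, norm_zero]

theorem coordPartial_eq {φ : evenPart 𝕜 V → Supernumber 𝕜} {c : Fin p ⊕ Fin q → Supernumber 𝕜}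
    {x : evenPart 𝕜 V} (h : HasFDerivAt φ (e.sumComponentMulL 𝔽 c) x) (A : Fin p ⊕ Fin q) :
    coordPartial e φ A x = c A := by
  have h' := (e.hasSuperPartials_iff_hasFDerivAt φ c x).2 h
  have hex : ∃ c, HasSuperPartials (fun z => φ (e.chartInv z)) c (e.chart x) := ⟨c, h'⟩
  rw [coordPartial, superPartial, dif_pos hex]
  exact congrFun (e.sumComponentMulL_injective (𝔽 := 𝔽) (HasFDerivAt.unique
    ((e.hasSuperPartials_iff_hasFDerivAt φ _ x).1 hex.choose_spec) h)) A

/-- Both branches of `superDeriv` give the same coefficient: the Fréchet derivative by evaluation at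
`e_A`, the coordinate formula because uniqueness makes the choice in `superPartial` harmless. -/
theorem superDeriv_basis {φ : evenPart 𝕜 V → Supernumber 𝕜} {c : Fin p ⊕ Fin q → Supernumber 𝕜}
    {x : evenPart 𝕜 V} (h : HasFDerivAt φ (e.sumComponentMulL 𝔽 c) x) (A : Fin p ⊕ Fin q) :
    superDeriv 𝔽 e φ x (e.toBasis A) = c A := by
  rw [superDeriv]
  split_ifs with hA
  · simp [h.fderiv, sumComponentMulL_apply, component_basis]
  · simp [component_basis, e.coordPartial_eq h]

/-- The value at even vectors of the form `∑ v₁^{A₁} ⋯ v_k^{A_k} c_A`. -/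
def superForm {k : ℕ} (c : (Fin k → Fin p ⊕ Fin q) → Supernumber 𝕜) (v : Fin k → evenPart 𝕜 V) :
    Supernumber 𝕜 :=
  ∑ A : Fin k → Fin p ⊕ Fin q, (List.ofFn fun i => e.component (v i : V) (A i)).prod * c A

/-! ### Evaluation and differentiation of the forms -/

theorem superForm_snoc {k : ℕ} (c : (Fin (k + 1) → Fin p ⊕ Fin q) → Supernumber 𝕜)
    (v : Fin k → evenPart 𝕜 V) (h : evenPart 𝕜 V) :
    e.superForm c (Fin.snoc (α := fun _ => evenPart 𝕜 V) v h) =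
      e.superForm (fun A => ∑ B, e.component (h : V) B *
        c (Fin.snoc (α := fun _ => Fin p ⊕ Fin q) A B)) v := by
  simp only [superForm]
  rw [← (Fin.snocEquiv fun _ => Fin p ⊕ Fin q).sum_comp, Fintype.sum_prod_type_right]
  refine Finset.sum_congr rfl fun A _ => ?_
  rw [Finset.mul_sum]
  refine Finset.sum_congr rfl fun B _ => ?_
  rw [List.ofFn_succ']
  simp [Fin.snocEquiv, mul_assoc]

theorem superForm_probeVector {k : ℕ} (c : (Fin k → Fin p ⊕ Fin q) → Supernumber 𝕜)
    (A : Fin k → Fin p ⊕ Fin q) (n : Fin k → ℕ) :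
    e.superForm c (fun i => e.probeVector (A i) (n i)) =
      (List.ofFn fun i => Supernumber.probe 𝕜 (A i) (n i)).prod * c A := by
  rw [superForm, Finset.sum_eq_single A]
  · simp [component_probeVector]
  · intro B _ hB
    obtain ⟨i, hi⟩ := Function.ne_iff.1 hB
    rw [List.prod_eq_zero, zero_mul]
    rw [List.mem_ofFn]
    exact ⟨i, by simp [component_probeVector, Ne.symm hi]⟩
  · simp

/-- Only the coefficients vary, and differentiating them produces `w^B` immediately to their left.
The new direction thus enters in the last slot, without any sign. -/
theorem fderiv_superForm {k : ℕ} {c : (Fin k → Fin p ⊕ Fin q) → evenPart 𝕜 V → Supernumber 𝕜}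
    {c' : (Fin (k + 1) → Fin p ⊕ Fin q) → Supernumber 𝕜} {x : evenPart 𝕜 V}
    (h : ∀ A, HasFDerivAt (c A) (e.sumComponentMulL 𝔽 fun B =>
      c' (Fin.snoc (α := fun _ => Fin p ⊕ Fin q) A B)) x) (v : Fin k → evenPart 𝕜 V)
    (w : evenPart 𝕜 V) :
    fderiv 𝔽 (fun y => e.superForm (fun A => c A y) v) x w =
      e.superForm c' (Fin.snoc (α := fun _ => evenPart 𝕜 V) v w) := by
  rw [superForm_snoc]
  have := HasFDerivAt.fun_sum (u := Finset.univ) fun A _ =>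
    (ContinuousLinearMap.mul 𝔽 (Supernumber 𝕜)
      (List.ofFn fun i => e.component (v i : V) (A i)).prod).hasFDerivAt.comp x (h A)
  have h2 := this.fderiv
  simp only [Function.comp_def, ContinuousLinearMap.mul_apply'] at h2
  simp only [superForm]
  rw [h2]
  simp [sumComponentMulL_apply]

theorem iterSuperDeriv_even {φ : evenPart 𝕜 V → Supernumber 𝕜} (hφ : ContDiff 𝔽 ∞ φ) (k : ℕ)
    (x : evenPart 𝕜 V) (v : Fin k → evenPart 𝕜 V) :
    iterSuperDeriv 𝔽 e φ k x (fun i => (v i : V)) = iteratedFDeriv 𝔽 k φ x v := by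
  induction k generalizing x with
  | zero => simp [iterSuperDeriv]
  | succ k ih =>
    rw [iterSuperDeriv, superDeriv, dif_pos (v 0).2]
    have : ∀ y, iterSuperDeriv 𝔽 e φ k y (Fin.tail fun i => (v i : V)) =
        iteratedFDeriv 𝔽 k φ y (Fin.tail v) := fun y => ih y (Fin.tail v)
    rw [funext this, fderiv_iteratedFDeriv_apply hφ, Subtype.coe_eta, Fin.cons_self_tail]

end

end PureBasis

namespace PureBasis

noncomputable section

variable {𝕜 : Type*} [RCLike 𝕜] {p q : ℕ}
  {V : Type*} [NormedAddCommGroup V] [NormedSpace 𝕜 V] [Module (Supernumber 𝕜) V]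
  [BanachSuperSpace 𝕜 V] (e : PureBasis 𝕜 p q V)

/-! ### Change of basis -/

/-- For odd `B` the vector `e_B` is not even, so the known parity of the components of the even
vectors `ζ^n e_B` is used, and the generator is then stripped off. -/
theorem component_basis_mem_ofParity {p' q' : ℕ} (e' : PureBasis 𝕜 p' q' V) (B : Fin p ⊕ Fin q)
    (A : Fin p' ⊕ Fin q') : e'.component (e.toBasis B) A ∈
      Supernumber.ofParity 𝕜 (indexParity A + indexParity B) :=
  Supernumber.mem_ofParity_of_probe_mul (A := B) fun n => by
    rw [← component_supernumber_smul]
    exact e'.component_mem (e.probeVector B n) A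

theorem component_eq_sum {p' q' : ℕ} (e' : PureBasis 𝕜 p' q' V) (v : V) (A : Fin p' ⊕ Fin q') :
    e'.component v A = ∑ B, e.component v B * e'.component (e.toBasis B) A := by
  conv_lhs => rw [← e.toBasis.sum_repr v]
  simp only [component, map_sum, Finsupp.finsetSum_apply, map_smul, Finsupp.smul_apply, smul_eq_mul]

theorem superForm_cons {k : ℕ} (c : (Fin (k + 1) → Fin p ⊕ Fin q) → Supernumber 𝕜)
    (v : Fin (k + 1) → evenPart 𝕜 V) :
    e.superForm c v = ∑ B, e.component (v 0 : V) B *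
      e.superForm (fun A => c (Fin.cons (α := fun _ => Fin p ⊕ Fin q) B A)) (Fin.tail v) := by
  simp only [superForm]
  rw [← (Fin.consEquiv fun _ => Fin p ⊕ Fin q).sum_comp, Fintype.sum_prod_type]
  refine Finset.sum_congr rfl fun B _ => ?_
  rw [Finset.mul_sum]
  refine Finset.sum_congr rfl fun A _ => ?_
  rw [List.ofFn_succ]
  simp [Fin.consEquiv, mul_assoc, Fin.tail]

/-- Substituting `v'^A = ∑ v^B t_B^A` leaves transition coefficients between the components. They
have pure parity, so they move to the right end with signs depending only on the indices and not on
`v`. -/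
theorem exists_prod_component_eq_superForm {p' q' : ℕ} (e' : PureBasis 𝕜 p' q' V) {k : ℕ}
    (A : Fin k → Fin p' ⊕ Fin q') : ∃ T : (Fin k → Fin p ⊕ Fin q) → Supernumber 𝕜,
      ∀ v : Fin k → evenPart 𝕜 V,
        (List.ofFn fun i => e'.component (v i : V) (A i)).prod = e.superForm T v := by
  induction k with
  | zero => exact ⟨fun _ => 1, fun v => by simp [superForm]⟩
  | succ k ih =>
    obtain ⟨T, hT⟩ := ih fun i => A i.succ
    choose t ht using fun (B : Fin p ⊕ Fin q) (C : Fin k → Fin p ⊕ Fin q) =>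
      Supernumber.exists_mul_prod_eq_prod_mul (fun i => indexParity (C i))
        (e.component_basis_mem_ofParity e' B (A 0))
    refine ⟨fun B => t (B 0) (Fin.tail B) * T (Fin.tail B), fun v => ?_⟩
    rw [List.ofFn_succ, List.prod_cons, hT fun i => v i.succ, superForm_cons,
      e.component_eq_sum e', Finset.sum_mul]
    refine Finset.sum_congr rfl fun B _ => ?_
    rw [mul_assoc]
    congr 1
    simp only [superForm, Finset.mul_sum, Fin.cons_zero, Fin.tail_cons]
    refine Finset.sum_congr rfl fun C _ => ?_
    rw [← mul_assoc, ht B C _ fun i => e.component_mem (v i.succ) (C i), mul_assoc]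
    rfl

theorem exists_superForm_eq {p' q' : ℕ} (e' : PureBasis 𝕜 p' q' V) {k : ℕ}
    (c' : (Fin k → Fin p' ⊕ Fin q') → Supernumber 𝕜) :
    ∃ c : (Fin k → Fin p ⊕ Fin q) → Supernumber 𝕜,
      ∀ v : Fin k → evenPart 𝕜 V, e'.superForm c' v = e.superForm c v := by
  choose T hT using fun A : Fin k → Fin p' ⊕ Fin q' => e.exists_prod_component_eq_superForm e' A
  refine ⟨fun B => ∑ A, T A B * c' A, fun v => ?_⟩
  rw [superForm]
  simp only [hT, superForm, Finset.mul_sum, Finset.sum_mul]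
  rw [Finset.sum_comm]
  simp only [mul_assoc]

/-! ### Super smoothness and Fréchet derivatives -/

variable {𝔽 : Type*} [RCLike 𝔽] [NormedAlgebra 𝔽 𝕜] [NormedSpace 𝔽 V] [IsScalarTower 𝔽 𝕜 V]

theorem hasSuperPartials_iff_hasFDerivAt_chartInv (φ : evenPart 𝕜 V → Supernumber 𝕜)
    (c : Fin p ⊕ Fin q → Supernumber 𝕜) (a : superModel 𝕜 p q) :
    HasSuperPartials (fun z => φ (e.chartInv z)) c a ↔
      HasFDerivAt φ (e.sumComponentMulL 𝔽 c) (e.chartInv a) := by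
  rw [← hasSuperPartials_iff_hasFDerivAt, chart_chartInv]

/-- No regularity of `c` is assumed. Probe vectors isolate one coefficient up to a left factor, and
removing that factor costs nothing in norm, so differentiability passes from the form to the
coefficient. -/
theorem hasFDerivAt_coeff {φ : evenPart 𝕜 V → Supernumber 𝕜} (hφ : ContDiff 𝔽 ∞ φ) {k : ℕ}
    {c : evenPart 𝕜 V → (Fin k → Fin p ⊕ Fin q) → Supernumber 𝕜}
    {c' : (Fin (k + 1) → Fin p ⊕ Fin q) → Supernumber 𝕜} {x : evenPart 𝕜 V}
    (hc : ∀ y v, iteratedFDeriv 𝔽 k φ y v = e.superForm (c y) v)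
    (hc' : ∀ v, iteratedFDeriv 𝔽 (k + 1) φ x v = e.superForm c' v)
    (A : Fin k → Fin p ⊕ Fin q) :
    HasFDerivAt (fun y => c y A) (e.sumComponentMulL 𝔽 fun B =>
      c' (Fin.snoc (α := fun _ => Fin p ⊕ Fin q) A B)) x := by
  obtain ⟨M, hM0, hM⟩ := e.exists_norm_probeVector_le
  have hd := (hφ.differentiable_iteratedFDeriv (m := k)
    (mod_cast ENat.natCast_lt_top k) x).hasFDerivAt
  rw [hasFDerivAt_iff_isLittleO_nhds_zero] at hd ⊢
  -- The constant `M ^ k` bounds the product of the norms of the `k` probe vectors, whatever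
  -- generators they use.
  refine (Asymptotics.IsBigO.of_bound (M ^ k) (Filter.Eventually.of_forall fun h => ?_)).trans_isLittleO
    hd
  refine Supernumber.norm_le_of_prod_probe_mul A fun n => ?_
  let v : Fin k → evenPart 𝕜 V := fun i => e.probeVector (A i) (n i)
  have key : (List.ofFn fun i => Supernumber.probe 𝕜 (A i) (n i)).prod *
      (c (x + h) A - c x A - e.sumComponentMulL 𝔽 (fun B =>
        c' (Fin.snoc (α := fun _ => Fin p ⊕ Fin q) A B)) h) =
      (iteratedFDeriv 𝔽 k φ (x + h) - iteratedFDeriv 𝔽 k φ x -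
        fderiv 𝔽 (iteratedFDeriv 𝔽 k φ) x h) v := by
    have h1 : fderiv 𝔽 (iteratedFDeriv 𝔽 k φ) x h v =
        iteratedFDeriv 𝔽 (k + 1) φ x (Fin.cons h v) := by
      rw [iteratedFDeriv_succ_apply_left, Fin.cons_zero, Fin.tail_cons]
    rw [sub_apply, sub_apply, h1,
      iteratedFDeriv_cons_eq_snoc hφ, hc, hc, hc', superForm_snoc, superForm_probeVector,
      superForm_probeVector, superForm_probeVector, sumComponentMulL_apply, mul_sub, mul_sub]
  rw [key, mul_comm]
  refine (ContinuousMultilinearMap.le_opNorm _ v).trans ?_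
  refine mul_le_mul_of_nonneg_left ?_ (norm_nonneg _)
  exact (Finset.prod_le_prod (fun i _ => norm_nonneg _) fun i _ => hM (A i) (n i)).trans
    (by simp)

theorem isG_coeff {φ : evenPart 𝕜 V → Supernumber 𝕜} (hφ : ContDiff 𝔽 ∞ φ)
    {c : (k : ℕ) → evenPart 𝕜 V → (Fin k → Fin p ⊕ Fin q) → Supernumber 𝕜}
    (hc : ∀ k x v, iteratedFDeriv 𝔽 k φ x v = e.superForm (c k x) v) (l k : ℕ)
    (A : Fin k → Fin p ⊕ Fin q) : IsG (l + 1) fun z => c k (e.chartInv z) A := by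
  have h : ∀ (k : ℕ) (A : Fin k → Fin p ⊕ Fin q) (a : superModel 𝕜 p q),
      HasSuperPartials (fun z => c k (e.chartInv z) A)
        (fun B => c (k + 1) (e.chartInv a) (Fin.snoc (α := fun _ => Fin p ⊕ Fin q) A B)) a :=
    fun k A a => (e.hasSuperPartials_iff_hasFDerivAt_chartInv (𝔽 := 𝔽) (fun y => c k y A) _ a).2
      (e.hasFDerivAt_coeff hφ (hc k) (hc (k + 1) _) A)
  induction l generalizing k with
  | zero => exact ⟨_, h k A⟩
  | succ l ih => exact ⟨_, h k A, fun B => ih (k + 1) _⟩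

theorem exists_partials_of_isG {φ : evenPart 𝕜 V → Supernumber 𝕜}
    (hφ : ∀ l, IsG (l + 1) fun z => φ (e.chartInv z)) :
    ∃ G : Fin p ⊕ Fin q → evenPart 𝕜 V → Supernumber 𝕜,
      (∀ A l, IsG (l + 1) fun z => G A (e.chartInv z)) ∧
        ∀ x, HasFDerivAt φ (e.sumComponentMulL 𝔽 fun A => G A x) x := by
  obtain ⟨G, hG⟩ := hφ 0
  refine ⟨fun A x => G A (e.chart x), fun A l => ?_, fun x =>
    (e.hasSuperPartials_iff_hasFDerivAt φ _ x).1 (hG _)⟩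
  -- Each smoothness class supplies its own family of partials; uniqueness identifies all of them
  -- with the one obtained from `G^1`.
  obtain ⟨G', hG', hl⟩ := hφ (l + 1)
  have : G' = G := by
    ext1 B
    ext1 a
    exact congrFun (e.sumComponentMulL_injective (𝔽 := 𝕜) (HasFDerivAt.unique
      ((e.hasSuperPartials_iff_hasFDerivAt_chartInv φ _ a).1 (hG' a))
      ((e.hasSuperPartials_iff_hasFDerivAt_chartInv φ _ a).1 (hG a)))) B
  simpa only [chart_chartInv, this] using hl A

/-- The derivative `d^k_x φ (e_{A_k}, …, e_{A_1})`. -/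
def iterPartial (𝔽 : Type*) [RCLike 𝔽] [NormedAlgebra 𝔽 𝕜] [NormedSpace 𝔽 V]
    [IsScalarTower 𝔽 𝕜 V] (φ : evenPart 𝕜 V → Supernumber 𝕜) {k : ℕ} (A : Fin k → Fin p ⊕ Fin q)
    (x : evenPart 𝕜 V) : Supernumber 𝕜 :=
  iterSuperDeriv 𝔽 e φ k x fun i => e.toBasis (A i.rev)

/-- The outermost derivative uses the first argument, which the reversal makes the last index. -/
theorem iterPartial_snoc (φ : evenPart 𝕜 V → Supernumber 𝕜) {k : ℕ} (A : Fin k → Fin p ⊕ Fin q)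
    (B : Fin p ⊕ Fin q) (x : evenPart 𝕜 V) :
    e.iterPartial 𝔽 φ (Fin.snoc (α := fun _ => Fin p ⊕ Fin q) A B) x =
      superDeriv 𝔽 e (e.iterPartial 𝔽 φ A) x (e.toBasis B) := by
  have h : (Fin.tail fun i : Fin (k + 1) =>
      e.toBasis (Fin.snoc (α := fun _ => Fin p ⊕ Fin q) A B i.rev)) =
      fun i => e.toBasis (A i.rev) := by
    ext1 i
    simp [Fin.tail, Fin.rev_succ]
  rw [iterPartial, iterSuperDeriv, h, Fin.rev_zero, Fin.snoc_last]
  rfl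

theorem isG_iterPartial {φ : evenPart 𝕜 V → Supernumber 𝕜}
    (hφ : ∀ l, IsG (l + 1) fun z => φ (e.chartInv z)) {k : ℕ} (A : Fin k → Fin p ⊕ Fin q) (l : ℕ) :
    IsG (l + 1) fun z => e.iterPartial 𝔽 φ A (e.chartInv z) := by
  induction k generalizing l with
  | zero => exact hφ l
  | succ k ih =>
    obtain ⟨G, hG, hd⟩ := e.exists_partials_of_isG (𝔽 := 𝔽) (ih (Fin.init A))
    rw [← Fin.snoc_init_self A]
    simp only [iterPartial_snoc, e.superDeriv_basis (hd _)]
    exact hG _ l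

theorem hasFDerivAt_iterPartial {φ : evenPart 𝕜 V → Supernumber 𝕜}
    (hφ : ∀ l, IsG (l + 1) fun z => φ (e.chartInv z)) {k : ℕ} (A : Fin k → Fin p ⊕ Fin q)
    (x : evenPart 𝕜 V) :
    HasFDerivAt (e.iterPartial 𝔽 φ A) (e.sumComponentMulL 𝔽 fun B =>
      e.iterPartial 𝔽 φ (Fin.snoc (α := fun _ => Fin p ⊕ Fin q) A B) x) x := by
  obtain ⟨G, hG, hd⟩ := e.exists_partials_of_isG (𝔽 := 𝔽) (e.isG_iterPartial (𝔽 := 𝔽) hφ A)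
  simp only [iterPartial_snoc, e.superDeriv_basis (hd _)]
  exact hd x

theorem iteratedFDeriv_eq_superForm {φ : evenPart 𝕜 V → Supernumber 𝕜} (hs : ContDiff 𝔽 ∞ φ)
    (hφ : ∀ l, IsG (l + 1) fun z => φ (e.chartInv z)) (k : ℕ) (x : evenPart 𝕜 V)
    (v : Fin k → evenPart 𝕜 V) :
    iteratedFDeriv 𝔽 k φ x v = e.superForm (fun A => e.iterPartial 𝔽 φ A x) v := by
  induction k generalizing x with
  | zero => simp [superForm, iterPartial, iterSuperDeriv]
  | succ k ih =>
    -- Symmetry brings the last vector to the front, where it is the direction in which the form of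
    -- order `k` is differentiated.
    rw [← Fin.snoc_init_self v, ← iteratedFDeriv_cons_eq_snoc hs,
      ← fderiv_iteratedFDeriv_apply hs, funext fun y => ih y (Fin.init v),
      e.fderiv_superForm (c := fun A => e.iterPartial 𝔽 φ A)
        (c' := fun A => e.iterPartial 𝔽 φ A x) fun A => e.hasFDerivAt_iterPartial hφ A x]

/-- A smooth function on the even part is `G^∞` if and only if its derivatives are multilinear over
the even part. -/
theorem isG_iff_isMultilinearOverEven {φ : evenPart 𝕜 V → Supernumber 𝕜} (hs : ContDiff 𝔽 ∞ φ) :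
    (∀ l, IsG (l + 1) fun z => φ (e.chartInv z)) ↔
      ∀ x k, 1 ≤ k → IsMultilinearOverEven 𝕜 (iterSuperDeriv 𝔽 e φ k x) := by
  constructor
  · intro hφ x k _
    refine ⟨p, q, e, fun v => ?_⟩
    rw [e.iterSuperDeriv_even hs, e.iteratedFDeriv_eq_superForm hs hφ]
    rfl
  · intro h
    have hex : ∀ k x, ∃ c : (Fin k → Fin p ⊕ Fin q) → Supernumber 𝕜,
        ∀ v, iteratedFDeriv 𝔽 k φ x v = e.superForm c v := by
      intro k x
      -- The hypothesis starts at `k = 1`; for `k = 0` the coefficient is `φ x` itself, so that `φ`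
      -- starts the chain of coefficients.
      rcases Nat.eq_zero_or_pos k with rfl | hk
      · exact ⟨fun _ => φ x, fun v => by simp [superForm]⟩
      · obtain ⟨p', q', e', he'⟩ := h x k hk
        -- The basis `e'` may vary with `x` and `k`. After the change of basis the coefficients need
        -- not be recognised as derivatives at basis vectors; their existence suffices.
        obtain ⟨c, hc⟩ := e.exists_superForm_eq e' fun A =>
          iterSuperDeriv 𝔽 e φ k x fun i => e'.toBasis (A i.rev)
        refine ⟨c, fun v => ?_⟩
        exact ((e.iterSuperDeriv_even hs k x v).symm.trans (he' v)).trans (hc v)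
    choose c hc using hex
    have h0 : ∀ x, φ x = c 0 x Fin.elim0 := fun x => by
      have := hc 0 x Fin.elim0
      rw [iteratedFDeriv_zero_apply] at this
      rw [this, superForm, Fintype.sum_unique]
      simp [Subsingleton.elim (default : Fin 0 → Fin p ⊕ Fin q) Fin.elim0]
    intro l
    simpa only [h0] using e.isG_coeff hs hc l 0 Fin.elim0

end

end PureBasis

/-! ### The proposition, reduced to the components of the map -/

theorem mainTheorem11 {𝕜 𝔽 : Type*} [RCLike 𝕜] [RCLike 𝔽] [NormedAlgebra 𝔽 𝕜]
    {g v : Type*}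
    [NormedAddCommGroup g] [NormedSpace 𝕜 g] [Module (Supernumber 𝕜) g] [BanachSuperSpace 𝕜 g]
    [NormedSpace 𝔽 g] [IsScalarTower 𝔽 𝕜 g]
    [NormedAddCommGroup v] [NormedSpace 𝕜 v] [Module (Supernumber 𝕜) v] [BanachSuperSpace 𝕜 v]
    [NormedSpace 𝔽 v] [IsScalarTower 𝔽 𝕜 v]
    {p q r s : ℕ} (e : PureBasis 𝕜 p q g) (e' : PureBasis 𝕜 r s v)
    (f : evenPart 𝕜 g → evenPart 𝕜 v) (hf : ContDiff 𝔽 ∞ f) :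
    IsGInfty e e' f ↔
      ∀ (x : evenPart 𝕜 g) (k : ℕ), 1 ≤ k → ∀ B : Fin r ⊕ Fin s,
        IsMultilinearOverEven 𝕜
          (iterSuperDeriv 𝔽 e (fun y => e'.component (f y : v) B) k x) := by
  have hs : ∀ B, ContDiff 𝔽 ∞ fun y => e'.component (f y : v) B := fun B =>
    ((e'.componentL 𝔽 B).comp ((evenPart 𝕜 v).subtypeL.restrictScalars 𝔽)).contDiff.comp hf
  have h := fun B => e.isG_iff_isMultilinearOverEven (hs B)
  constructor
  · intro hG x k hk B
    exact (h B).1 (fun l => hG B (l + 1) (Nat.le_add_left 1 l)) x k hk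
  · intro hM B l hl
    obtain ⟨l, rfl⟩ := Nat.exists_eq_add_of_le' hl
    exact (h B).2 (fun x k hk => hM x k hk B) l
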